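/- Let $\nu$ be a northeast path from $(0,0)$ to $(m,n)$, that is, a lattice path with finitely many steps $N=(0,1)$ and $E=(1,0)$. Let $F_\nu$ be the Ferrers diagram lying weakly above $\nu$ in the rectangle $[0,m]\times[0,n]$, and let $A_\nu$ be the set of lattice points in $F_\nu$. A *$\nu$-path* is a northeast path from $(0,0)$ to $(m,n)$ that stays weakly above $\nu$; $\mathcal D_\nu$ denotes the set of $\nu$-paths. A *valley* of a path is a lattice point on it that is preceded by an east step and followed by a north step; a *return* of a $\nu$-path $\mu$ is a valley of $\mu$ that is also a valley of $\nu$. Let $\mathrm{val}(\mu)$ and $\mathrm{ret}(\mu)$ be the numbers of valleys and of returns of $\mu$, let $\deg(\nu)=\max\{\mathrm{val}(\mu):\mu\in\mathcal D_\nu\}$, and let $$H_\nu(x,y)=\sum_{\mu\in\mathcal D_\nu}x^{\mathrm{val}(\mu)}y^{\mathrm{ret}(\mu)}.$$ Two points of $A_\nu$ are *$\nu$-incompatible* if one is strictly southwest of the other and the smallest axis-parallel rectangle containing both lies in $F_\nu$; otherwise they are *$\nu$-compatible*. A *covering $\nu$-face* is a set $C\subseteq A_\nu$ of pairwise $\nu$-compatible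 points that contains $(0,n)$ and at least one point in each column $0,\dots,m$ and in each row $0,\dots,n$. Put $\dim(C)=m+n+1-|C|$. Let $\mathrm{rel}(C)$ be the number of points $p\in C$ in the first column (column $0$) such that the row of $p$ contains another point of $C$ and contains a valley of $\nu$. Put $\mathrm{corel}(C)=\deg(\nu)-\dim(C)-\mathrm{rel}(C)$ and $$F_\nu(x,y)=\sum_{C}x^{\mathrm{corel}(C)}y^{\mathrm{rel}(C)},$$ where the sum is over all covering $\nu$-faces $C$. **Theorem.** For every northeast path $\nu$, all the exponents $\mathrm{corel}(C)$ are nonnegative, so that $F_\nu$ is a polynomial, and $$F_\nu(x,y)=x^{\deg(\nu)}\,H_\nu\!\left(\frac{x+1}{x},\frac{y+1}{x+1}\right);$$ equivalently, $$H_\nu(x,y)=(x-1)^{\deg(\nu)}\,F_\nu\!\left(\frac{1}{x-1},\frac{x(y-1)+1}{x-1}\right).$$ Both are identities of rational functions in $x,y$. They hold for all elements $x,y$ of any field with $x\neq0$, $x\neq-1$ in the first identity, and with $x\neq1$ in the second. -/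

import Mathlib

namespace NuTamari

/-- A unit lattice step: north `(0,1)` or east `(1,0)`. -/
inductive Step
  | N
  | E
  deriving DecidableEq

/-- A northeast path, starting at the origin, given as its word in the letters `N` and `E`. -/
abbrev NEPath := List Step

/-- The end point of a northeast path. The first coordinate is the column, the second the row. -/
def endpoint (μ : NEPath) : ℕ × ℕ := (μ.count Step.E, μ.count Step.N)

/-- The lattice points on a northeast path: the end points of its initial segments. -/
def latticePoints (μ : NEPath) : Finset (ℕ × ℕ) :=
  (Finset.range (μ.length + 1)).image fun k => endpoint (μ.take k)

/-- The valleys of a northeast path: its lattice points that are preceded by an east step and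
followed by a north step. -/
def valleys (μ : NEPath) : Finset (ℕ × ℕ) :=
  ((Finset.range μ.length).filter fun k =>
    μ[k]? = some Step.E ∧ μ[k + 1]? = some Step.N).image fun k => endpoint (μ.take (k + 1))

/-- `A_ν`: the lattice points of the bounding rectangle of `ν` that lie weakly above `ν`, that is,
the lattice points of the Ferrers diagram `F_ν`. -/
def region (ν : NEPath) : Finset (ℕ × ℕ) :=
  (Finset.Icc (0, 0) (endpoint ν)).filter fun p =>
    ∃ q ∈ latticePoints ν, q.1 = p.1 ∧ q.2 ≤ p.2

/-- A `ν`-path: a northeast path with the same end point as `ν` which stays weakly above `ν`. -/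
def IsNuPath (ν μ : NEPath) : Prop :=
  endpoint μ = endpoint ν ∧ latticePoints μ ⊆ region ν

instance (ν μ : NEPath) : Decidable (IsNuPath ν μ) :=
  inferInstanceAs (Decidable (_ ∧ _))

/-- `D_ν`, the finite set of all `ν`-paths (see `mem_nuPaths`). -/
def nuPaths (ν : NEPath) : Finset NEPath :=
  ν.permutations.toFinset.filter fun μ => IsNuPath ν μ

theorem mem_nuPaths {ν μ : NEPath} : μ ∈ nuPaths ν ↔ IsNuPath ν μ := by
  simp only [nuPaths, Finset.mem_filter, List.mem_toFinset, List.mem_permutations,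
    and_iff_right_iff_imp]
  intro h
  have h1 := h.1
  simp only [endpoint, Prod.mk.injEq] at h1
  rw [List.perm_iff_count]
  intro s
  cases s
  · exact h1.2
  · exact h1.1

/-- The number of valleys of a path. -/
def val (μ : NEPath) : ℕ := (valleys μ).card

/-- The number of returns of a `ν`-path: the valleys that are also valleys of `ν`. -/
def ret (ν μ : NEPath) : ℕ := (valleys μ ∩ valleys ν).card

/-- The degree of `ν`: the maximal number of valleys of a `ν`-path. -/
def deg (ν : NEPath) : ℕ := (nuPaths ν).sup val

/-- Two points are `ν`-incompatible if one is strictly southwest of the other and the smallest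
rectangle containing both lies in the Ferrers diagram of `ν`. -/
def Incompatible (ν : NEPath) (p q : ℕ × ℕ) : Prop :=
  ((p.1 < q.1 ∧ p.2 < q.2) ∨ (q.1 < p.1 ∧ q.2 < p.2)) ∧
    Finset.Icc (p ⊓ q) (p ⊔ q) ⊆ region ν

instance (ν : NEPath) (p q : ℕ × ℕ) : Decidable (Incompatible ν p q) :=
  inferInstanceAs (Decidable (_ ∧ _))

/-- A `ν`-face: a set of pairwise `ν`-compatible points of `A_ν`. -/
def IsFace (ν : NEPath) (C : Finset (ℕ × ℕ)) : Prop :=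
  C ⊆ region ν ∧ ∀ p ∈ C, ∀ q ∈ C, ¬ Incompatible ν p q

instance (ν : NEPath) (C : Finset (ℕ × ℕ)) : Decidable (IsFace ν C) :=
  inferInstanceAs (Decidable (_ ∧ _))

/-- A covering `ν`-face: a `ν`-face that contains the top-left corner of `A_ν` and at least one
point in each column and in each row. -/
def IsCoveringFace (ν : NEPath) (C : Finset (ℕ × ℕ)) : Prop :=
  IsFace ν C ∧ (0, (endpoint ν).2) ∈ C ∧
    (∀ i ∈ Finset.range ((endpoint ν).1 + 1), ∃ p ∈ C, p.1 = i) ∧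
    (∀ j ∈ Finset.range ((endpoint ν).2 + 1), ∃ p ∈ C, p.2 = j)

instance (ν : NEPath) (C : Finset (ℕ × ℕ)) : Decidable (IsCoveringFace ν C) :=
  inferInstanceAs (Decidable (_ ∧ _ ∧ _ ∧ _))

/-- The faces of the `ν`-associahedron: the finite set of all covering `ν`-faces
(see `mem_asso`). -/
def asso (ν : NEPath) : Finset (Finset (ℕ × ℕ)) :=
  (region ν).powerset.filter fun C => IsCoveringFace ν C

theorem mem_asso {ν : NEPath} {C : Finset (ℕ × ℕ)} : C ∈ asso ν ↔ IsCoveringFace ν C := by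
  simp only [asso, Finset.mem_filter, Finset.mem_powerset, and_iff_right_iff_imp]
  exact fun h => h.1.1

/-- The dimension `m + n + 1 - |C|` of a face, for `ν` a path from `(0,0)` to `(m,n)`. -/
def dim (ν : NEPath) (C : Finset (ℕ × ℕ)) : ℤ :=
  (endpoint ν).1 + (endpoint ν).2 + 1 - C.card

/-- The relevant points of `C`: those in the first column whose row contains another point of `C`
and contains a valley of `ν`. -/
def Rel (ν : NEPath) (C : Finset (ℕ × ℕ)) : Finset (ℕ × ℕ) :=
  C.filter fun p =>
    p.1 = 0 ∧ (∃ q ∈ C, q ≠ p ∧ q.2 = p.2) ∧ ∃ v ∈ valleys ν, v.2 = p.2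

/-- The number of relevant points of `C`. -/
def rel (ν : NEPath) (C : Finset (ℕ × ℕ)) : ℕ := (Rel ν C).card

/-- The statistic `corel(C) = deg(ν) - dim(C) - rel(C)`, as an integer. -/
def corel (ν : NEPath) (C : Finset (ℕ × ℕ)) : ℤ := deg ν - dim ν C - rel ν C

/-- The `F`-triangle, a polynomial in `x = X 0` and `y = X 1`. The theorem asserts that `corel` is
nonnegative on all faces, so that `Int.toNat` only changes the type of the exponent. -/
noncomputable def FTriangle (ν : NEPath) : MvPolynomial (Fin 2) ℤ :=
  ∑ C ∈ asso ν, MvPolynomial.X 0 ^ (corel ν C).toNat * MvPolynomial.X 1 ^ rel ν C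

/-- The `H`-triangle, a polynomial in `x = X 0` and `y = X 1`. -/
noncomputable def HTriangle (ν : NEPath) : MvPolynomial (Fin 2) ℤ :=
  ∑ μ ∈ nuPaths ν, MvPolynomial.X 0 ^ val μ * MvPolynomial.X 1 ^ ret ν μ

end NuTamari

/-! Both triangles come from one identity, `sum_asso_eq_sum_nuPaths`: the sum of `t ^ dim * y ^ rel`
over covering faces equals the sum over `ν`-paths in which each return weighs `y + t` and every
other valley `1 + t`. Putting `t = 1 / x` and `y / x` for `y` gives `F`, while in `H` a return
weighs `x * y` and another valley `x`; matching these weights gives both substitutions.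

The identity holds because both sides satisfy the recursion `rowSum`, which processes rows from the
bottom up. For paths (`pathSum_eq_rowSum`) the choice in a row is the column `i'` in which the path
leaves it; there is a valley there exactly when the path has moved east in that row. For faces, the
lowest row is determined by its leftmost column `a`: a higher point in a column strictly right of
`a` and within the row would be incompatible with the leftmost point, so column covering forces the
lowest row to contain all available columns from `a` on (`IsPartialFace.exists_addRow`). The only
other choice is whether column `a` is used again higher up; if not, the dimension grows by one,
hence a factor `t` (`faceSum_succ`). Only the number of surviving columns matters afterwards, and
each value arises at most once from keeping `a` and once from dropping it, which produces `1 + t`.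
At the row end the kept column is `0`, giving `y + t` if the row has a valley of `ν`
(`faceSum_eq_rowSum`).

Nonnegativity of `corel` follows by comparing degrees in the identity over `ℕ[X]`, where nothing
cancels. -/

namespace NuTamari

open Finset

/-! ### Path words, row ends of the diagram, and valleys -/

theorem mem_latticePoints {μ : NEPath} {p : ℕ × ℕ} :
    p ∈ latticePoints μ ↔ ∃ k ≤ μ.length, endpoint (μ.take k) = p := by
  simp [latticePoints]

theorem mem_valleys {μ : NEPath} {p : ℕ × ℕ} :
    p ∈ valleys μ ↔
      ∃ k, μ[k]? = some Step.E ∧ μ[k + 1]? = some Step.N ∧ endpoint (μ.take (k + 1)) = p := by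
  simp only [valleys, mem_image, mem_filter, mem_range]
  constructor
  · rintro ⟨k, ⟨-, h1, h2⟩, h3⟩
    exact ⟨k, h1, h2, h3⟩
  · rintro ⟨k, h1, h2, h3⟩
    exact ⟨k, ⟨(List.getElem?_eq_some_iff.1 h1).1, h1, h2⟩, h3⟩

theorem endpoint_take_mono (μ : NEPath) {k l : ℕ} (h : k ≤ l) :
    endpoint (μ.take k) ≤ endpoint (μ.take l) :=
  have hs : (μ.take k).Sublist (μ.take l) := (List.take_prefix_take_left h).sublist
  ⟨hs.count_le _, hs.count_le _⟩

theorem endpoint_take_le (μ : NEPath) (k : ℕ) : endpoint (μ.take k) ≤ endpoint μ :=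
  ⟨(List.take_sublist k μ).count_le _, (List.take_sublist k μ).count_le _⟩

theorem endpoint_take_succ (μ : NEPath) (k : ℕ) :
    endpoint (μ.take (k + 1)) =
      endpoint (μ.take k) + ((if μ[k]? = some Step.E then 1 else 0),
        (if μ[k]? = some Step.N then 1 else 0)) := by
  rw [List.take_add_one]
  rcases h : μ[k]? with _ | s
  · simp [endpoint]
  · cases s <;> simp [endpoint]

theorem exists_take_column (μ : NEPath) (k i : ℕ) (h : i ≤ (endpoint (μ.take k)).1) :
    ∃ l ≤ k, (endpoint (μ.take l)).1 = i := by
  induction k with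
  | zero => exact ⟨0, le_rfl, by simp [endpoint] at h ⊢; omega⟩
  | succ k ih =>
    by_cases hk : i ≤ (endpoint (μ.take k)).1
    · obtain ⟨l, hl, h⟩ := ih hk
      exact ⟨l, by omega, h⟩
    · refine ⟨k + 1, le_rfl, ?_⟩
      rw [endpoint_take_succ] at h ⊢
      simp only [Prod.fst_add] at h ⊢
      split_ifs at h ⊢ <;> omega

/-- The rightmost column of the Ferrers diagram of `ν` in row `j`. -/
def rowEnd (ν : NEPath) (j : ℕ) : ℕ := ((latticePoints ν).filter fun q => q.2 ≤ j).sup Prod.fst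

theorem rowEnd_mono (ν : NEPath) : Monotone (rowEnd ν) := fun _ _ h =>
  sup_mono (monotone_filter_right _ fun _ _ hq => le_trans hq h)

theorem le_rowEnd_of_mem {ν : NEPath} {q : ℕ × ℕ} {j : ℕ} (hq : q ∈ latticePoints ν)
    (h : q.2 ≤ j) : q.1 ≤ rowEnd ν j :=
  le_sup (f := Prod.fst) (mem_filter.2 ⟨hq, h⟩)

theorem exists_rowEnd (ν : NEPath) (j : ℕ) :
    ∃ k ≤ ν.length, (endpoint (ν.take k)).1 = rowEnd ν j ∧ (endpoint (ν.take k)).2 ≤ j := by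
  have hne : ((latticePoints ν).filter fun q => q.2 ≤ j).Nonempty :=
    ⟨(0, 0), mem_filter.2 ⟨mem_latticePoints.2 ⟨0, by simp, by simp [endpoint]⟩, by simp⟩⟩
  obtain ⟨q, hq, h⟩ := exists_mem_eq_sup _ hne Prod.fst
  rw [mem_filter, mem_latticePoints] at hq
  obtain ⟨⟨k, hk, rfl⟩, h2⟩ := hq
  exact ⟨k, hk, h.symm, h2⟩

theorem rowEnd_le (ν : NEPath) (j : ℕ) : rowEnd ν j ≤ (endpoint ν).1 := by
  obtain ⟨k, -, h, -⟩ := exists_rowEnd ν j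
  exact h ▸ (endpoint_take_le ν k).1

theorem rowEnd_top (ν : NEPath) : rowEnd ν (endpoint ν).2 = (endpoint ν).1 :=
  le_antisymm (rowEnd_le _ _)
    (le_rowEnd_of_mem (mem_latticePoints.2 ⟨ν.length, le_rfl, by simp⟩) le_rfl)

/-- Reduces the diagram to the monotone function `rowEnd ν`, the only form in which it enters the
recursions. -/
theorem mem_region {ν : NEPath} {p : ℕ × ℕ} :
    p ∈ region ν ↔ p.2 ≤ (endpoint ν).2 ∧ p.1 ≤ rowEnd ν p.2 := by
  simp only [region, mem_filter, mem_Icc]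
  constructor
  · rintro ⟨⟨-, h⟩, q, hq, h1, h2⟩
    exact ⟨h.2, h1 ▸ le_rowEnd_of_mem hq h2⟩
  · rintro ⟨h1, h2⟩
    refine ⟨⟨⟨Nat.zero_le _, Nat.zero_le _⟩, h2.trans (rowEnd_le _ _), h1⟩, ?_⟩
    obtain ⟨k, hk, hk1, hk2⟩ := exists_rowEnd ν p.2
    obtain ⟨l, hl, hl1⟩ := exists_take_column ν k p.1 (hk1 ▸ h2)
    exact ⟨_, mem_latticePoints.2 ⟨l, by omega, rfl⟩, hl1,
      (endpoint_take_mono ν hl).2.trans hk2⟩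

theorem snd_lt_of_mem_valleys {ν : NEPath} {p : ℕ × ℕ} (hp : p ∈ valleys ν) :
    p.2 < (endpoint ν).2 := by
  obtain ⟨k, -, h, rfl⟩ := mem_valleys.1 hp
  have := (endpoint_take_le ν (k + 1 + 1)).2
  rw [endpoint_take_succ, if_pos h] at this
  exact this

theorem fst_eq_of_mem_valleys {ν : NEPath} {p : ℕ × ℕ} (hp : p ∈ valleys ν) :
    p.1 = rowEnd ν p.2 := by
  obtain ⟨k, -, h, rfl⟩ := mem_valleys.1 hp
  have hk := (List.getElem?_eq_some_iff.1 h).1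
  apply le_antisymm
  · exact le_rowEnd_of_mem (mem_latticePoints.2 ⟨k + 1, hk.le, rfl⟩) le_rfl
  · obtain ⟨l, -, h1, h2⟩ := exists_rowEnd ν (endpoint (ν.take (k + 1))).2
    rw [← h1]
    -- Past the north step that follows the valley, the path is strictly above the valley's row.
    have hl : l ≤ k + 1 := by
      by_contra hl
      have := (endpoint_take_mono ν (show k + 1 + 1 ≤ l by omega)).2
      rw [endpoint_take_succ, if_pos h] at this
      simp only [Prod.snd_add] at this
      omega
    exact (endpoint_take_mono ν hl).1

/-- The rows of the valleys of `ν`. -/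
def valleyRows (ν : NEPath) : Finset ℕ := (valleys ν).image Prod.snd

/-- A valley of `ν` is the end of its row, so being a return can be read off from the row ends and
the set of valley rows. -/
theorem mem_valleys_iff {ν : NEPath} {p : ℕ × ℕ} :
    p ∈ valleys ν ↔ p.1 = rowEnd ν p.2 ∧ p.2 ∈ valleyRows ν := by
  constructor
  · exact fun h => ⟨fst_eq_of_mem_valleys h, mem_image_of_mem _ h⟩
  · rintro ⟨h1, h2⟩
    obtain ⟨v, hv, h⟩ := mem_image.1 h2
    have : v = p := Prod.ext (by rw [h1, ← h, fst_eq_of_mem_valleys hv]) h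
    exact this ▸ hv

theorem top_notMem_valleyRows (ν : NEPath) : (endpoint ν).2 ∉ valleyRows ν := by
  intro h
  obtain ⟨v, hv, h⟩ := mem_image.1 h
  exact (snd_lt_of_mem_valleys hv).ne h

/-! ### Paths and their valleys by first-step recursion -/

/-- The valleys of a path that starts at `p`; the flag tells whether the step into `p` is an east
step. -/
def valleysFrom : Bool → ℕ × ℕ → NEPath → Finset (ℕ × ℕ)
  | _, _, [] => ∅
  | _, p, Step.E :: μ => valleysFrom true (p.1 + 1, p.2) μ
  | true, p, Step.N :: μ => insert p (valleysFrom false (p.1, p.2 + 1) μ)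
  | false, p, Step.N :: μ => valleysFrom false (p.1, p.2 + 1) μ

theorem mem_valleysFrom {μ : NEPath} {b : Bool} {p q : ℕ × ℕ} :
    q ∈ valleysFrom b p μ ↔ (b = true ∧ μ[0]? = some Step.N ∧ q = p) ∨
      ∃ k, μ[k]? = some Step.E ∧ μ[k + 1]? = some Step.N ∧
        q = p + endpoint (μ.take (k + 1)) := by
  induction μ generalizing b p with
  | nil => simp [valleysFrom]
  | cons s μ ih =>
    have hs : (∃ k, (s :: μ)[k]? = some Step.E ∧ (s :: μ)[k + 1]? = some Step.N ∧
        q = p + endpoint ((s :: μ).take (k + 1))) ↔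
        (s = Step.E ∧ μ[0]? = some Step.N ∧ q = p + endpoint [s]) ∨
        ∃ k, μ[k]? = some Step.E ∧ μ[k + 1]? = some Step.N ∧
          q = p + endpoint (s :: μ.take (k + 1)) := by
      constructor
      · rintro ⟨_ | k, h1, h2, h3⟩
        · left; simpa using ⟨by simpa using h1, by simpa using h2, h3⟩
        · right; exact ⟨k, by simpa using h1, by simpa using h2, by simpa using h3⟩
      · rintro (⟨h1, h2, h3⟩ | ⟨k, h1, h2, h3⟩)
        · exact ⟨0, by simp [h1], by simpa using h2, by simpa using h3⟩
        · exact ⟨k + 1, by simpa using h1, by simpa using h2, by simpa using h3⟩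
    rw [hs]
    have he (l : NEPath) : p + endpoint (Step.E :: l) = (p.1 + 1, p.2) + endpoint l := by
      ext <;> simp [endpoint]
      omega
    have hn (l : NEPath) : p + endpoint (Step.N :: l) = (p.1, p.2 + 1) + endpoint l := by
      ext <;> simp [endpoint]
      omega
    have h0 : endpoint [] = 0 := rfl
    cases s
    · cases b <;> simp only [valleysFrom, mem_insert, ih, hn] <;> simp
    · simp only [valleysFrom, ih, he, h0]; simp

theorem valleysFrom_origin (μ : NEPath) : valleysFrom false (0, 0) μ = valleys μ := by
  ext q
  rw [mem_valleysFrom, mem_valleys]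
  have : ((0, 0) : ℕ × ℕ) = 0 := rfl
  simp [this, eq_comm]

theorem le_snd_of_mem_valleysFrom {μ : NEPath} {b : Bool} {p q : ℕ × ℕ}
    (h : q ∈ valleysFrom b p μ) : p.2 ≤ q.2 := by
  rcases mem_valleysFrom.1 h with ⟨-, -, rfl⟩ | ⟨k, -, -, rfl⟩ <;> simp

/-- The northeast paths with `ℓ` steps from `(i, j)` to `(R n, n)` that stay inside the diagram
with row ends `R`. -/
def pathsFrom (R : ℕ → ℕ) (n : ℕ) : ℕ → ℕ → ℕ → Finset NEPath
  | 0, i, j => if i = R n ∧ j = n then {[]} else ∅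
  | ℓ + 1, i, j =>
    (if i < R j then (pathsFrom R n ℓ (i + 1) j).map ⟨_, List.cons_injective (a := Step.E)⟩
      else ∅) ∪
    (if j < n then (pathsFrom R n ℓ i (j + 1)).map ⟨_, List.cons_injective (a := Step.N)⟩
      else ∅)

theorem mem_pathsFrom {R : ℕ → ℕ} (hR : Monotone R) {n ℓ i j : ℕ} (hj : j ≤ n) (hi : i ≤ R j)
    {μ : NEPath} :
    μ ∈ pathsFrom R n ℓ i j ↔ μ.length = ℓ ∧ (i, j) + endpoint μ = (R n, n) ∧
      ∀ k ≤ μ.length, ((i, j) + endpoint (μ.take k)).2 ≤ n ∧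
        ((i, j) + endpoint (μ.take k)).1 ≤ R ((i, j) + endpoint (μ.take k)).2 := by
  induction ℓ generalizing i j μ with
  | zero =>
    have h0 : endpoint [] = 0 := rfl
    simp only [pathsFrom]
    split_ifs with h
    · obtain ⟨rfl, rfl⟩ := h
      simp only [mem_singleton]
      constructor
      · rintro rfl
        simp [h0]
      · exact fun h => List.length_eq_zero_iff.1 h.1
    · simp only [notMem_empty, List.length_eq_zero_iff, false_iff]
      rintro ⟨rfl, h1, -⟩
      rw [h0] at h1
      simp at h1
      exact h h1
  | succ ℓ ih =>
    have he (l : NEPath) : (i, j) + endpoint (Step.E :: l) = (i + 1, j) + endpoint l := by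
      ext <;> simp [endpoint]
      omega
    have hn (l : NEPath) : (i, j) + endpoint (Step.N :: l) = (i, j + 1) + endpoint l := by
      ext <;> simp [endpoint]
      omega
    have h0 : (i, j) + endpoint [] = (i, j) := rfl
    have hsucc {Q : ℕ → Prop} (N : ℕ) : (∀ k ≤ N + 1, Q k) ↔ Q 0 ∧ ∀ k ≤ N, Q (k + 1) := by
      constructor
      · exact fun h => ⟨h 0 (by omega), fun k hk => h _ (by omega)⟩
      · rintro ⟨h1, h2⟩ (_ | k) hk
        · exact h1
        · exact h2 k (by omega)
    rcases μ with _ | ⟨_ | _, μ⟩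
    · simp only [pathsFrom]
      split_ifs <;> simp
    · have : (Step.N :: μ) ∈ pathsFrom R n (ℓ + 1) i j ↔
          j < n ∧ μ ∈ pathsFrom R n ℓ i (j + 1) := by
        simp only [pathsFrom]
        split_ifs <;> simp_all
      rw [this]
      simp only [List.length_cons, hsucc, hn, List.take_zero, h0, List.take_succ_cons]
      by_cases hjn : j < n
      · rw [ih (by omega) (hi.trans (hR (by omega)))]
        simp [hjn, hj, hi]
      · simp only [hjn, false_and, false_iff]
        rintro ⟨-, h, -⟩
        simp [Prod.ext_iff] at h
        omega
    · have : (Step.E :: μ) ∈ pathsFrom R n (ℓ + 1) i j ↔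
          i < R j ∧ μ ∈ pathsFrom R n ℓ (i + 1) j := by
        simp only [pathsFrom]
        split_ifs <;> simp_all
      rw [this]
      simp only [List.length_cons, hsucc, he, List.take_zero, h0, List.take_succ_cons]
      by_cases hjn : i < R j
      · rw [ih hj (by omega)]
        simp [hjn, hj, hi]
      · simp only [hjn, false_and, false_iff]
        rintro ⟨-, h, -, h2⟩
        have := (h2 0 (by omega)).2
        rw [List.take_zero] at this
        change i + 1 + 0 ≤ R (j + 0) at this
        simp at this
        omega

theorem pathsFrom_eq_nuPaths (ν : NEPath) :
    pathsFrom (rowEnd ν) (endpoint ν).2 (rowEnd ν (endpoint ν).2 + (endpoint ν).2) 0 0 =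
      nuPaths ν := by
  ext μ
  rw [mem_pathsFrom (rowEnd_mono ν) (Nat.zero_le _) (Nat.zero_le _), mem_nuPaths, rowEnd_top]
  have h0 : ((0, 0) : ℕ × ℕ) = 0 := rfl
  have hl : μ.length = (endpoint μ).1 + (endpoint μ).2 := by
    simp only [endpoint]
    induction μ with
    | nil => rfl
    | cons s μ ih => cases s <;> simp [ih] <;> omega
  simp only [h0, zero_add, IsNuPath, subset_iff, mem_latticePoints, mem_region]
  constructor
  · rintro ⟨-, h1, h2⟩
    refine ⟨h1, ?_⟩
    rintro p ⟨k, hk, rfl⟩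
    exact h2 k hk
  · rintro ⟨h1, h2⟩
    exact ⟨by rw [hl, h1], h1, fun k hk => h2 ⟨k, hk, rfl⟩⟩

/-! ### Weighted path counts, row by row -/

variable {K : Type*} [CommSemiring K]

/-- The weighted number of paths from `(i, n - d)` to the top right corner, computed row by row:
the weight of a path is the product of the weights of its valleys. -/
def rowSum (R : ℕ → ℕ) (n : ℕ) (g : ℕ × ℕ → K) : ℕ → ℕ → K
  | 0, _ => 1
  | d + 1, i => ∑ i' ∈ Icc i (R (n - (d + 1))),
      (if i' = i then 1 else g (i', n - (d + 1))) * rowSum R n g d i'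

/-- The sum of the weights of the paths in `pathsFrom`. -/
def pathSum (R : ℕ → ℕ) (n : ℕ) (g : ℕ × ℕ → K) (ℓ : ℕ) (b : Bool) (i j : ℕ) : K :=
  ∑ μ ∈ pathsFrom R n ℓ i j, ∏ p ∈ valleysFrom b (i, j) μ, g p

theorem pathSum_succ (R : ℕ → ℕ) (n : ℕ) (g : ℕ × ℕ → K) (ℓ : ℕ) (b : Bool) (i j : ℕ) :
    pathSum R n g (ℓ + 1) b i j =
      (if i < R j then pathSum R n g ℓ true (i + 1) j else 0) +
      (if j < n then (if b then g (i, j) else 1) * pathSum R n g ℓ false i (j + 1) else 0) := by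
  simp only [pathSum, pathsFrom]
  rw [sum_union]
  · congr 1
    · split_ifs
      · simp [valleysFrom]
      · simp
    · split_ifs with h hb
      · subst hb
        rw [sum_map, mul_sum]
        refine sum_congr rfl fun μ _ => ?_
        simp only [Function.Embedding.coeFn_mk, valleysFrom]
        rw [prod_insert]
        intro h
        have := le_snd_of_mem_valleysFrom h
        simp at this
      · simp [valleysFrom, hb]
      · simp
  · rw [disjoint_left]
    intro μ h1 h2
    split_ifs at h1 h2 <;> simp_all
    obtain ⟨_, _, rfl⟩ := h1
    simp at h2

theorem pathSum_top (R : ℕ → ℕ) (n : ℕ) (g : ℕ × ℕ → K) (ℓ : ℕ) (b : Bool) (i : ℕ)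
    (h : i + ℓ = R n) : pathSum R n g ℓ b i n = 1 := by
  induction ℓ generalizing i b with
  | zero => simp [pathSum, pathsFrom, show i = R n by omega, valleysFrom]
  | succ ℓ ih => rw [pathSum_succ, if_pos (by omega), if_neg (by omega), ih _ _ (by omega), add_zero]

/-- Group the paths by the column `i'` in which they leave the current row. Leaving in the entry
column `i` makes no valley, since the flag `false` says that no east step leads into the starting
point. -/
theorem pathSum_eq_rowSum {R : ℕ → ℕ} (hR : Monotone R) (n : ℕ) (g : ℕ × ℕ → K) (d i : ℕ)
    (hd : d ≤ n) (hi : i ≤ R (n - d)) :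
    pathSum R n g (R n - i + d) false i (n - d) = rowSum R n g d i := by
  induction d generalizing i with
  | zero => exact pathSum_top _ _ _ _ _ _ (by simp at hi; omega)
  | succ d ih =>
    have hj : n - d = n - (d + 1) + 1 := by omega
    have hle : R (n - (d + 1)) ≤ R (n - d) := hR (by omega)
    have hle' : R (n - (d + 1)) ≤ R n := hR (by omega)
    -- Induction on the number `e` of east steps still available in the row. The flag has to vary:
    -- after an east step, leaving at once is also a valley.
    have key (e : ℕ) : ∀ (b : Bool) (i : ℕ), i + e = R (n - (d + 1)) →
        pathSum R n g (R n - i + (d + 1)) b i (n - (d + 1)) =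
          ∑ i' ∈ Icc i (R (n - (d + 1))),
            (if i' = i then (if b then g (i', n - (d + 1)) else 1) else g (i', n - (d + 1))) *
              rowSum R n g d i' := by
      induction e with
      | zero =>
        intro b i h
        rw [← add_assoc, pathSum_succ, if_neg (by omega), if_pos (by omega), ← hj,
          ih i (by omega) (by omega)]
        simp [← h]
      | succ e ihe =>
        intro b i h
        rw [← add_assoc, pathSum_succ, if_pos (by omega), if_pos (by omega), ← hj,
          ih i (by omega) (by omega), show R n - i + d = R n - (i + 1) + (d + 1) by omega,
          ihe _ _ (by omega), ← Finset.insert_Icc_add_one_left_eq_Icc (show i ≤ _ by omega),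
          sum_insert (by simp), add_comm]
        congr 1
        · simp
        · refine sum_congr rfl fun i' hi' => ?_
          have := (mem_Icc.1 hi').1
          rw [if_neg (show i' ≠ i by omega)]
          simp
    rw [key (R (n - (d + 1)) - i) _ _ (by omega)]
    simp [rowSum]

/-! ### Partial covering faces and their lowest row -/

/-- A covering face on the rows `b, …, n` of the diagram with row ends `R` whose set of columns is
`W`. -/
structure IsPartialFace (R : ℕ → ℕ) (n b : ℕ) (W : Finset ℕ) (C : Finset (ℕ × ℕ)) : Prop where
  col_mem : ∀ p ∈ C, p.1 ∈ W
  le_row : ∀ p ∈ C, b ≤ p.2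
  row_le : ∀ p ∈ C, p.2 ≤ n
  col_le : ∀ p ∈ C, p.1 ≤ R p.2
  compat : ∀ p ∈ C, ∀ q ∈ C, p.1 < q.1 → p.2 < q.2 → R p.2 < q.1
  root_mem : (0, n) ∈ C
  col_cover : ∀ i ∈ W, ∃ j, (i, j) ∈ C
  row_cover : ∀ j, b ≤ j → j ≤ n → ∃ i, (i, j) ∈ C

open Classical in
/-- The finite set of all partial covering faces. -/
noncomputable def partialFaces (R : ℕ → ℕ) (n b : ℕ) (W : Finset ℕ) : Finset (Finset (ℕ × ℕ)) :=
  (W ×ˢ Icc b n).powerset.filter (IsPartialFace R n b W)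

theorem mem_partialFaces {R : ℕ → ℕ} {n b : ℕ} {W : Finset ℕ} {C : Finset (ℕ × ℕ)} :
    C ∈ partialFaces R n b W ↔ IsPartialFace R n b W C := by
  simp only [partialFaces, mem_filter, mem_powerset, and_iff_right_iff_imp]
  intro h p hp
  exact mem_product.2 ⟨h.col_mem p hp, mem_Icc.2 ⟨h.le_row p hp, h.row_le p hp⟩⟩

/-- The points of `C` in the first column that lie in a row in `J` and are not alone in their
row. -/
def relPoints (J : Finset ℕ) (C : Finset (ℕ × ℕ)) : Finset (ℕ × ℕ) :=
  C.filter fun p => p.1 = 0 ∧ (∃ q ∈ C, q ≠ p ∧ q.2 = p.2) ∧ p.2 ∈ J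

/-- The columns of `W` between `a` and `r`. -/
def colsFrom (W : Finset ℕ) (r a : ℕ) : Finset ℕ := W.filter fun v => a ≤ v ∧ v ≤ r

/-- Add to `C` the points of row `b` in the columns of `W` between `a` and `r`. -/
def addRow (W : Finset ℕ) (r b a : ℕ) (C : Finset (ℕ × ℕ)) : Finset (ℕ × ℕ) :=
  C ∪ colsFrom W r a ×ˢ {b}

theorem mem_colsFrom {W : Finset ℕ} {r a v : ℕ} :
    v ∈ colsFrom W r a ↔ v ∈ W ∧ a ≤ v ∧ v ≤ r := by simp [colsFrom]

theorem mem_addRow {W : Finset ℕ} {r b a : ℕ} {C : Finset (ℕ × ℕ)} {p : ℕ × ℕ} :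
    p ∈ addRow W r b a C ↔ p ∈ C ∨ (p.1 ∈ W ∧ a ≤ p.1 ∧ p.1 ≤ r) ∧ p.2 = b := by
  simp only [addRow, mem_union, mem_product, mem_singleton, mem_colsFrom]

theorem card_addRow {W : Finset ℕ} {r b a : ℕ} {C : Finset (ℕ × ℕ)} (hC : ∀ p ∈ C, b < p.2) :
    (addRow W r b a C).card = C.card + (colsFrom W r a).card := by
  rw [addRow, card_union_of_disjoint, card_product, card_singleton, mul_one]
  rw [disjoint_left]
  intro p hp hp'
  exact (hC p hp).ne' (mem_singleton.1 (mem_product.1 hp').2)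

theorem filter_addRow {W : Finset ℕ} {r b a : ℕ} {C : Finset (ℕ × ℕ)} (hC : ∀ p ∈ C, b < p.2) :
    (addRow W r b a C).filter (fun p => b < p.2) = C := by
  ext p
  rw [mem_filter, mem_addRow]
  constructor
  · rintro ⟨h | h, h'⟩
    · exact h
    · omega
  · exact fun h => ⟨Or.inl h, hC p h⟩

/-- Relevance depends only on a point's own row, so the higher rows keep their count. The one new
candidate is `(0, b)`, which is present only if `a = 0` and has company only if the row has two
points. -/
theorem card_relPoints_addRow {W : Finset ℕ} {r b a : ℕ} {C : Finset (ℕ × ℕ)} (J : Finset ℕ)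
    (hC : ∀ p ∈ C, b < p.2) (h0 : 0 ∈ W) :
    (relPoints J (addRow W r b a C)).card = (relPoints J C).card +
      if a = 0 ∧ 2 ≤ (colsFrom W r a).card ∧ b ∈ J then 1 else 0 := by
  have h : relPoints J (addRow W r b a C) = relPoints J C ∪
      if a = 0 ∧ 2 ≤ (colsFrom W r a).card ∧ b ∈ J then {(0, b)} else ∅ := by
    ext p
    simp only [relPoints, mem_filter, mem_union, mem_addRow]
    constructor
    · rintro ⟨hp | ⟨⟨h1, h2, h3⟩, h4⟩, h5, ⟨q, hq, hqp, hq2⟩, h6⟩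
      · left
        refine ⟨hp, h5, ⟨q, ?_, hqp, hq2⟩, h6⟩
        have := hC p hp
        rcases hq with hq | hq
        · exact hq
        · omega
      · right
        have hq' : (q.1 ∈ W ∧ a ≤ q.1 ∧ q.1 ≤ r) ∧ q.2 = b := by
          rcases hq with hq | hq
          · have := hC q hq
            omega
          · exact hq
        rw [if_pos, mem_singleton]
        · exact Prod.ext h5 h4
        · refine ⟨by omega, ?_, h4 ▸ h6⟩
          refine one_lt_card.2 ⟨q.1, mem_colsFrom.2 hq'.1, p.1, mem_colsFrom.2 ⟨h1, h2, h3⟩, ?_⟩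
          exact fun h => hqp (Prod.ext h hq2)
    · rintro (⟨hp, h5, ⟨q, hq, hqp, hq2⟩, h6⟩ | h)
      · exact ⟨Or.inl hp, h5, ⟨q, Or.inl hq, hqp, hq2⟩, h6⟩
      · split_ifs at h with hc
        · obtain ⟨rfl, hc, hJ⟩ := hc
          rw [mem_singleton] at h
          subst h
          obtain ⟨q, hq, hq0⟩ := exists_mem_ne hc 0
          have hq' := mem_colsFrom.1 hq
          refine ⟨Or.inr ⟨⟨h0, le_rfl, by simp⟩, rfl⟩, rfl, ⟨(q, b), Or.inr ⟨hq', rfl⟩, ?_, rfl⟩, hJ⟩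
          simpa using hq0
        · simp at h
  rw [h, card_union_of_disjoint]
  · split_ifs <;> simp
  · rw [disjoint_left]
    intro p hp hp'
    have := hC p (mem_filter.1 hp).1
    split_ifs at hp'
    · simp at hp'
      simp [hp'] at this
    · simp at hp'

/-- The columns that remain if row `b` starts in column `a` and column `a` is used again. -/
def colsKeep (W : Finset ℕ) (r a : ℕ) : Finset ℕ := W.filter fun v => ¬ (a < v ∧ v ≤ r)

/-- The columns that remain if row `b` starts in column `a` and column `a` is not used again. -/
def colsDrop (W : Finset ℕ) (r a : ℕ) : Finset ℕ := W.filter fun v => ¬ (a ≤ v ∧ v ≤ r)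

theorem card_colsDrop (W : Finset ℕ) (r a : ℕ) :
    (colsDrop W r a).card + (colsFrom W r a).card = W.card := by
  rw [add_comm]
  exact card_filter_add_card_filter_not _

theorem card_colsKeep {W : Finset ℕ} {r a : ℕ} (ha : a ∈ W) (har : a ≤ r) :
    (colsKeep W r a).card + (colsFrom W r a).card = W.card + 1 := by
  have : colsKeep W r a = insert a (colsDrop W r a) := by
    ext v
    simp only [colsKeep, colsDrop, mem_filter, mem_insert]
    constructor
    · rintro ⟨h1, h2⟩
      by_cases h : v = a
      · exact Or.inl h
      · exact Or.inr ⟨h1, by omega⟩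
    · rintro (rfl | ⟨h1, h2⟩)
      · exact ⟨ha, by omega⟩
      · exact ⟨h1, by omega⟩
  rw [this, card_insert_of_notMem (by simp [colsDrop, har]), ← card_colsDrop W r a]
  omega

/-- No column of `W'` lies strictly right of `a` and within row `b`, so no new point is incompatible
with an old one. The bounds on `W'` cover both the case where column `a` is used again and the case
where it is not. -/
theorem IsPartialFace.addRow {R : ℕ → ℕ} {n b a : ℕ} {W W' : Finset ℕ} {C : Finset (ℕ × ℕ)}
    (hb : b < n) (ha : a ∈ W) (haR : a ≤ R b) (h1 : W' ⊆ colsKeep W (R b) a)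
    (h2 : colsDrop W (R b) a ⊆ W') (hC : IsPartialFace R n (b + 1) W' C) :
    IsPartialFace R n b W (addRow W (R b) b a C) where
  col_mem p hp := by
    rcases mem_addRow.1 hp with hp | hp
    · exact (mem_filter.1 (h1 (hC.col_mem p hp))).1
    · exact hp.1.1
  le_row p hp := by
    rcases mem_addRow.1 hp with hp | hp
    · have := hC.le_row p hp
      omega
    · omega
  row_le p hp := by
    rcases mem_addRow.1 hp with hp | hp
    · exact hC.row_le p hp
    · omega
  col_le p hp := by
    rcases mem_addRow.1 hp with hp | hp
    · exact hC.col_le p hp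
    · rw [hp.2]
      exact hp.1.2.2
  compat p hp q hq hpq hpq' := by
    rcases mem_addRow.1 hp with hp | hp <;> rcases mem_addRow.1 hq with hq | hq
    · exact hC.compat p hp q hq hpq hpq'
    · have := hC.le_row p hp
      omega
    · have := (mem_filter.1 (h1 (hC.col_mem q hq))).2
      rw [hp.2]
      omega
    · omega
  root_mem := mem_addRow.2 (Or.inl hC.root_mem)
  col_cover i hi := by
    by_cases h : a ≤ i ∧ i ≤ R b
    · exact ⟨b, mem_addRow.2 (Or.inr ⟨⟨hi, h⟩, rfl⟩)⟩
    · obtain ⟨j, hj⟩ := hC.col_cover i (h2 (mem_filter.2 ⟨hi, h⟩))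
      exact ⟨j, mem_addRow.2 (Or.inl hj)⟩
  row_cover j hj hjn := by
    rcases hj.eq_or_lt with rfl | hj
    · exact ⟨a, mem_addRow.2 (Or.inr ⟨⟨ha, le_rfl, haR⟩, rfl⟩)⟩
    · obtain ⟨i, hi⟩ := hC.row_cover j hj hjn
      exact ⟨i, mem_addRow.2 (Or.inl hi)⟩

/-- Take `a` leftmost in row `b`. Compatibility with `(a, b)` keeps higher points out of the columns
in `(a, R b]`, so row `b` alone must cover those of them in `W`. Whether column `a` recurs higher up
decides between `colsKeep` and `colsDrop`. -/
theorem IsPartialFace.exists_addRow {R : ℕ → ℕ} {n b : ℕ} {W : Finset ℕ}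
    {C : Finset (ℕ × ℕ)} (hb : b < n) (hC : IsPartialFace R n b W C) :
    ∃ a ∈ W, a ≤ R b ∧ ∃ C', (IsPartialFace R n (b + 1) (colsKeep W (R b) a) C' ∨
      IsPartialFace R n (b + 1) (colsDrop W (R b) a) C') ∧
      NuTamari.addRow W (R b) b a C' = C := by
  have hne : ∃ i, (i, b) ∈ C := hC.row_cover b le_rfl hb.le
  classical
  obtain ⟨a, haC, hmin⟩ : ∃ a, (a, b) ∈ C ∧ ∀ i, (i, b) ∈ C → a ≤ i :=
    ⟨Nat.find hne, Nat.find_spec hne, fun i hi => Nat.find_min' hne hi⟩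
  have haW := hC.col_mem _ haC
  have haR := hC.col_le _ haC
  have hkeep : ∀ p ∈ C, b < p.2 → ¬ (a < p.1 ∧ p.1 ≤ R b) := by
    intro p hp hbp h
    have := hC.compat _ haC p hp h.1 hbp
    simp only at this
    omega
  have hcov : ∀ i ∈ W, ¬ (a ≤ i ∧ i ≤ R b) → ∃ j, (i, j) ∈ C.filter fun p => b < p.2 := by
    intro i hi h
    obtain ⟨j, hj⟩ := hC.col_cover i hi
    refine ⟨j, mem_filter.2 ⟨hj, ?_⟩⟩
    by_contra hjb
    obtain rfl : j = b := le_antisymm (by simpa using hjb) (hC.le_row _ hj)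
    exact h ⟨hmin i hj, hC.col_le _ hj⟩
  have main (W' : Finset ℕ) (h1 : ∀ p ∈ C, b < p.2 → p.1 ∈ W')
      (h2 : ∀ i ∈ W', ∃ j, (i, j) ∈ C.filter fun p => b < p.2) :
      IsPartialFace R n (b + 1) W' (C.filter fun p => b < p.2) :=
    { col_mem := fun p hp => h1 p (mem_filter.1 hp).1 (mem_filter.1 hp).2
      le_row := fun p hp => (mem_filter.1 hp).2
      row_le := fun p hp => hC.row_le p (mem_filter.1 hp).1
      col_le := fun p hp => hC.col_le p (mem_filter.1 hp).1
      compat := fun p hp q hq => hC.compat p (mem_filter.1 hp).1 q (mem_filter.1 hq).1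
      root_mem := mem_filter.2 ⟨hC.root_mem, hb⟩
      col_cover := h2
      row_cover := fun j hj hjn => by
        obtain ⟨i, hi⟩ := hC.row_cover j (by omega) hjn
        exact ⟨i, mem_filter.2 ⟨hi, hj⟩⟩ }
  refine ⟨a, haW, haR, C.filter fun p => b < p.2, ?_, ?_⟩
  · by_cases hau : ∃ j, (a, j) ∈ C.filter fun p => b < p.2
    · left
      refine main _ (fun p hp hbp => mem_filter.2 ⟨hC.col_mem p hp, hkeep p hp hbp⟩) ?_
      intro i hi
      rcases eq_or_ne i a with rfl | hia
      · exact hau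
      · have := (mem_filter.1 hi).2
        exact hcov i (mem_filter.1 hi).1 (by omega)
    · right
      refine main _ (fun p hp hbp => mem_filter.2 ⟨hC.col_mem p hp, ?_⟩) ?_
      · have h1 := hkeep p hp hbp
        have h2 : p.1 ≠ a := by
          intro h
          exact hau ⟨p.2, mem_filter.2 ⟨by rw [← h]; exact hp, hbp⟩⟩
        omega
      · intro i hi
        exact hcov i (mem_filter.1 hi).1 (mem_filter.1 hi).2
  · ext p
    rw [mem_addRow, mem_filter]
    constructor
    · rintro (h | ⟨⟨h1, h2, h3⟩, h4⟩)
      · exact h.1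
      · rcases h2.eq_or_lt with h2 | h2
        · rwa [show p = (a, b) from Prod.ext h2.symm h4]
        · obtain ⟨j, hj⟩ := hC.col_cover p.1 h1
          have hjb : ¬ b < j := fun hjb => hkeep _ hj hjb ⟨h2, h3⟩
          have hbj : b ≤ j := hC.le_row _ hj
          rwa [show p = (p.1, j) from Prod.ext rfl (by simp only; omega)]
    · intro hp
      by_cases hbp : b < p.2
      · exact Or.inl ⟨hp, hbp⟩
      · have h : p.2 = b := le_antisymm (by omega) (hC.le_row p hp)
        refine Or.inr ⟨⟨hC.col_mem p hp, hmin _ (by rw [← h]; exact hp), ?_⟩, h⟩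
        rw [← h]
        exact hC.col_le p hp

theorem IsPartialFace.lt_snd {R : ℕ → ℕ} {n b : ℕ} {W : Finset ℕ} {C : Finset (ℕ × ℕ)}
    (hC : IsPartialFace R n (b + 1) W C) : ∀ p ∈ C, b < p.2 := hC.le_row

/-- Ensures that the natural subtraction in the exponent of `faceSum` does not truncate. -/
theorem IsPartialFace.card_le {R : ℕ → ℕ} {n b : ℕ} {W : Finset ℕ} {C : Finset (ℕ × ℕ)}
    (hb : b ≤ n) (hC : IsPartialFace R n b W C) : C.card ≤ W.card + (n - b) := by
  induction hb using Nat.decreasingInduction generalizing W C with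
  | self =>
    have : C ⊆ W ×ˢ {n} := fun p hp => mem_product.2
      ⟨hC.col_mem p hp, mem_singleton.2 (le_antisymm (hC.row_le p hp) (hC.le_row p hp))⟩
    simpa using card_le_card this
  | of_succ b hb ih =>
    obtain ⟨a, ha, haR, C', hC' | hC', rfl⟩ := hC.exists_addRow hb
    · have h1 := card_addRow (W := W) (r := R b) (a := a) hC'.lt_snd
      have h2 := card_colsKeep ha haR
      have h3 := ih hC'
      omega
    · have h1 := card_addRow (W := W) (r := R b) (a := a) hC'.lt_snd
      have h2 := card_colsDrop W (R b) a
      have h3 := ih hC'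
      omega

/-! ### The face generating function and its recursion -/

/-- The sum of `t ^ dim * y ^ rel` over all partial covering faces. -/
noncomputable def faceSum (R : ℕ → ℕ) (n : ℕ) (J : Finset ℕ) (t y : K) (b : ℕ) (W : Finset ℕ) : K :=
  ∑ C ∈ partialFaces R n b W, t ^ (W.card + (n - b) - C.card) * y ^ (relPoints J C).card

theorem faceSum_top {R : ℕ → ℕ} {n : ℕ} {J : Finset ℕ} (t y : K) {W : Finset ℕ}
    (hJ : n ∉ J) (h0 : 0 ∈ W) (hW : ∀ v ∈ W, v ≤ R n) : faceSum R n J t y n W = 1 := by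
  have h : partialFaces R n n W = {W ×ˢ {n}} := by
    ext C
    rw [mem_partialFaces, mem_singleton]
    constructor
    · intro hC
      ext p
      rw [mem_product, mem_singleton]
      have hn : ∀ p ∈ C, p.2 = n := fun p hp => le_antisymm (hC.row_le p hp) (hC.le_row p hp)
      constructor
      · exact fun hp => ⟨hC.col_mem p hp, hn p hp⟩
      · rintro ⟨h1, h2⟩
        obtain ⟨j, hj⟩ := hC.col_cover _ h1
        rwa [show p = (p.1, j) from Prod.ext rfl (h2.trans (hn _ hj).symm)]
    · rintro rfl
      constructor <;> simp only [mem_product, mem_singleton]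
      · exact fun p hp => hp.1
      · exact fun p hp => hp.2.ge
      · exact fun p hp => hp.2.le
      · exact fun p hp => hp.2 ▸ hW _ hp.1
      · intros
        omega
      · exact ⟨h0, trivial⟩
      · exact fun i hi => ⟨n, hi, rfl⟩
      · exact fun j h1 h2 => ⟨0, h0, le_antisymm h2 h1⟩
  have hrel : relPoints J (W ×ˢ {n}) = ∅ := by
    rw [relPoints, filter_eq_empty_iff]
    rintro p hp ⟨-, -, h⟩
    rw [mem_singleton.1 (mem_product.1 hp).2] at h
    exact hJ h
  rw [faceSum, h, sum_singleton, hrel]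
  simp

/-- Removing the lowest row is a bijection. The new row has as many points as there are columns in
`colsFrom`. Keeping `a` therefore preserves the dimension, and dropping it raises the dimension by
one. -/
theorem faceSum_succ {R : ℕ → ℕ} {n b : ℕ} (J : Finset ℕ) (t y : K) {W : Finset ℕ} (hb : b < n)
    (h0 : 0 ∈ W) :
    faceSum R n J t y b W = ∑ a ∈ colsFrom W (R b) 0,
      y ^ (if a = 0 ∧ 2 ≤ (colsFrom W (R b) a).card ∧ b ∈ J then 1 else 0) *
        (faceSum R n J t y (b + 1) (colsKeep W (R b) a) +
          t * faceSum R n J t y (b + 1) (colsDrop W (R b) a)) := by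
  classical
  have hdisj (a : ℕ) (ha : a ∈ colsFrom W (R b) 0) :
      Disjoint (partialFaces R n (b + 1) (colsKeep W (R b) a))
        (partialFaces R n (b + 1) (colsDrop W (R b) a)) := by
    rw [disjoint_left]
    intro C h1 h2
    rw [mem_partialFaces] at h1 h2
    rw [mem_colsFrom] at ha
    obtain ⟨j, hj⟩ := h1.col_cover a (mem_filter.2 ⟨ha.1, by omega⟩)
    have := (mem_filter.1 (h2.col_mem _ hj)).2
    simp only at this
    omega
  have hstep (a : ℕ) (ha : a ∈ colsFrom W (R b) 0) :
      y ^ (if a = 0 ∧ 2 ≤ (colsFrom W (R b) a).card ∧ b ∈ J then 1 else 0) *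
        (faceSum R n J t y (b + 1) (colsKeep W (R b) a) +
          t * faceSum R n J t y (b + 1) (colsDrop W (R b) a)) =
      ∑ C ∈ partialFaces R n (b + 1) (colsKeep W (R b) a) ∪
          partialFaces R n (b + 1) (colsDrop W (R b) a),
        t ^ (W.card + (n - b) - (addRow W (R b) b a C).card) *
          y ^ (relPoints J (addRow W (R b) b a C)).card := by
    have ha' := mem_colsFrom.1 ha
    rw [sum_union (hdisj a ha), mul_add]
    congr 1
    · rw [faceSum, mul_sum]
      refine sum_congr rfl fun C hC => ?_
      have hC' := mem_partialFaces.1 hC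
      rw [card_relPoints_addRow J hC'.lt_snd h0, card_addRow hC'.lt_snd, pow_add,
        show (colsKeep W (R b) a).card + (n - (b + 1)) - C.card =
          W.card + (n - b) - (C.card + (colsFrom W (R b) a).card) by
            have := card_colsKeep ha'.1 ha'.2.2
            have := hC'.card_le hb
            omega]
      ring
    · rw [faceSum, mul_sum, mul_sum]
      refine sum_congr rfl fun C hC => ?_
      have hC' := mem_partialFaces.1 hC
      rw [card_relPoints_addRow J hC'.lt_snd h0, card_addRow hC'.lt_snd, pow_add,
        show W.card + (n - b) - (C.card + (colsFrom W (R b) a).card) =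
          (colsDrop W (R b) a).card + (n - (b + 1)) - C.card + 1 by
            have := card_colsDrop W (R b) a
            have := hC'.card_le hb
            omega]
      ring
  rw [sum_congr rfl hstep, sum_sigma', faceSum]
  symm
  have hrow : ∀ x ∈ (colsFrom W (R b) 0).sigma fun a =>
      partialFaces R n (b + 1) (colsKeep W (R b) a) ∪
        partialFaces R n (b + 1) (colsDrop W (R b) a), x.1 ∈ W ∧ x.1 ≤ R b ∧
        (∀ p ∈ x.2, b < p.2) ∧ IsPartialFace R n b W (addRow W (R b) b x.1 x.2) := by
    rintro ⟨a, C⟩ hx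
    rw [mem_sigma, mem_union, mem_partialFaces, mem_partialFaces, mem_colsFrom] at hx
    obtain ⟨⟨ha, -, haR⟩, hC | hC⟩ := hx
    · refine ⟨ha, haR, hC.lt_snd, hC.addRow hb ha haR Subset.rfl ?_⟩
      exact monotone_filter_right _ fun v _ hv => by omega
    · refine ⟨ha, haR, hC.lt_snd, hC.addRow hb ha haR ?_ Subset.rfl⟩
      exact monotone_filter_right _ fun v _ hv => by omega
  refine sum_bij (fun x _ => addRow W (R b) b x.1 x.2) ?_ ?_ ?_ ?_
  · exact fun x hx => mem_partialFaces.2 (hrow x hx).2.2.2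
  · rintro ⟨a, C⟩ hx ⟨a', C'⟩ hx' h
    obtain ⟨ha, haR, hC, -⟩ := hrow _ hx
    obtain ⟨ha', haR', hC', -⟩ := hrow _ hx'
    simp only at h ha haR hC ha' haR' hC'
    have hmem (a₁ a₂ : ℕ) (C₁ C₂ : Finset (ℕ × ℕ)) (ha₁ : a₁ ∈ W) (hR₁ : a₁ ≤ R b)
        (hC₂ : ∀ p ∈ C₂, b < p.2) (h : addRow W (R b) b a₁ C₁ = addRow W (R b) b a₂ C₂) :
        a₂ ≤ a₁ := by
      have : (a₁, b) ∈ addRow W (R b) b a₂ C₂ :=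
        h ▸ mem_addRow.2 (Or.inr ⟨⟨ha₁, le_rfl, hR₁⟩, rfl⟩)
      rcases mem_addRow.1 this with h | h
      · exact absurd (hC₂ _ h) (lt_irrefl b)
      · exact h.1.2.1
    obtain rfl : a = a' := le_antisymm (hmem _ _ _ _ ha' haR' hC h.symm) (hmem _ _ _ _ ha haR hC' h)
    obtain rfl : C = C' := by
      rw [← filter_addRow (W := W) (r := R b) (a := a) hC, h, filter_addRow hC']
    rfl
  · intro C hC
    obtain ⟨a, ha, haR, C', hC', h⟩ := (mem_partialFaces.1 hC).exists_addRow hb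
    refine ⟨⟨a, C'⟩, ?_, h⟩
    rw [mem_sigma, mem_union, mem_partialFaces, mem_partialFaces, mem_colsFrom]
    exact ⟨⟨ha, Nat.zero_le _, haR⟩, hC'⟩
  · exact fun _ _ => rfl

/-- Sending `a` to the number of listed columns from `a` on is a bijection onto `1, …, k`, where `k`
is the number of listed columns. -/
theorem sum_card_colsFrom {M : Type*} [AddCommMonoid M] (f : ℕ → M) (W : Finset ℕ) (r : ℕ) :
    ∑ a ∈ colsFrom W r 0, f (colsFrom W r a).card =
      ∑ q ∈ range (colsFrom W r 0).card, f (q + 1) := by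
  have h (U : Finset ℕ) : ∑ a ∈ U, f (U.filter fun v => a ≤ v).card =
      ∑ q ∈ range U.card, f (q + 1) := by
    induction U using Finset.induction_on_min with
    | empty => simp
    | insert a U hU ih =>
      have ha : a ∉ U := fun h => lt_irrefl a (hU a h)
      rw [sum_insert ha, card_insert_of_notMem ha, sum_range_succ, ← ih, add_comm]
      congr 1
      · refine sum_congr rfl fun b hb => ?_
        rw [filter_insert, if_neg (by have := hU b hb; omega)]
      · rw [filter_true_of_mem, card_insert_of_notMem ha]
        intro v hv
        rcases mem_insert.1 hv with rfl | hv
        · exact le_rfl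
        · exact (hU v hv).le
  rw [← h]
  refine sum_congr rfl fun a _ => ?_
  congr 2
  ext v
  simp only [mem_colsFrom, mem_filter]
  exact ⟨fun h => ⟨⟨h.1, Nat.zero_le _, h.2.2⟩, h.2.1⟩, fun h => ⟨h.1.1, h.2, h.1.2.2⟩⟩

/-- Only the cardinality of `W` matters: `R n + 1 - W.card`, the number of columns already
discarded, plays the part of the path's current column. The hypothesis `hW'` says that columns
beyond the current row end are still present, so the cardinality determines how many columns meet
the row. -/
theorem faceSum_eq_rowSum {R : ℕ → ℕ} (hR : Monotone R) {n : ℕ} {J : Finset ℕ} (hJ : n ∉ J)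
    (t y : K) (d : ℕ) (hd : d ≤ n) (W : Finset ℕ) (h0 : 0 ∈ W) (hW : ∀ v ∈ W, v ≤ R n)
    (hW' : ∀ v, R (n - d) < v → v ≤ R n → v ∈ W) :
    faceSum R n J t y (n - d) W =
      rowSum R n (fun p => if p.1 = R p.2 ∧ p.2 ∈ J then y + t else 1 + t) d
        (R n + 1 - W.card) := by
  induction d generalizing W with
  | zero => exact faceSum_top t y hJ h0 hW
  | succ d ih =>
    have hd' : n - d = n - (d + 1) + 1 := by omega
    have hb : n - (d + 1) < n := by omega
    rw [rowSum, faceSum_succ J t y hb h0, ← hd']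
    have hRb : R (n - (d + 1)) ≤ R n := hR hb.le
    have hRd : R (n - (d + 1)) ≤ R (n - d) := hR (by omega)
    set b := n - (d + 1)
    set A := rowSum R n (fun p => if p.1 = R p.2 ∧ p.2 ∈ J then y + t else 1 + t) d
    have hcard : W.card = (colsFrom W (R b) 0).card + (R n - R b) := by
      have h : W = colsFrom W (R b) 0 ∪ Ioc (R b) (R n) := by
        ext v
        rw [mem_union, mem_colsFrom, mem_Ioc]
        constructor
        · intro hv
          have := hW v hv
          by_cases hv' : v ≤ R b
          · exact Or.inl ⟨hv, Nat.zero_le _, hv'⟩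
          · right
            omega
        · rintro (h | h)
          · exact h.1
          · exact hW' v h.1 h.2
      conv_lhs => rw [h]
      rw [card_union_of_disjoint, Nat.card_Ioc]
      rw [disjoint_left]
      intro v hv hv'
      rw [mem_colsFrom] at hv
      rw [mem_Ioc] at hv'
      omega
    have hk0 : 0 ∈ colsFrom W (R b) 0 := mem_colsFrom.2 ⟨h0, le_rfl, Nat.zero_le _⟩
    have hkle : (colsFrom W (R b) 0).card ≤ R b + 1 := by
      have : colsFrom W (R b) 0 ⊆ range (R b + 1) := fun v hv => by
        rw [mem_colsFrom] at hv
        rw [mem_range]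
        omega
      simpa using card_le_card this
    -- The leftmost column `0` is recognised by its count being maximal, which makes the relevance
    -- factor a function of the count alone.
    have hzero (a : ℕ) (ha : a ∈ colsFrom W (R b) 0) :
        a = 0 ↔ (colsFrom W (R b) a).card = (colsFrom W (R b) 0).card := by
      constructor
      · rintro rfl
        rfl
      · intro h
        have hsub : colsFrom W (R b) a ⊆ colsFrom W (R b) 0 :=
          monotone_filter_right _ fun v _ hv => ⟨Nat.zero_le _, hv.2⟩
        rw [← eq_of_subset_of_card_le hsub h.ge, mem_colsFrom] at hk0
        omega
    set k := (colsFrom W (R b) 0).card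
    set i := R n + 1 - W.card with hi
    have hik : i + k = R b + 1 := by omega
    have hstep (a : ℕ) (ha : a ∈ colsFrom W (R b) 0) :
        y ^ (if a = 0 ∧ 2 ≤ (colsFrom W (R b) a).card ∧ b ∈ J then 1 else 0) *
          (faceSum R n J t y (n - d) (colsKeep W (R b) a) +
            t * faceSum R n J t y (n - d) (colsDrop W (R b) a)) =
        (fun c => (if c = k ∧ 2 ≤ c ∧ b ∈ J then y else 1) * A (i + (c - 1)) +
          if c = k then 0 else t * A (i + c)) (colsFrom W (R b) a).card := by
      have ha' := mem_colsFrom.1 ha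
      have hc1 := card_colsKeep ha'.1 ha'.2.2
      have hc2 := card_colsDrop W (R b) a
      have hcpos : 0 < (colsFrom W (R b) a).card :=
        card_pos.2 ⟨a, mem_colsFrom.2 ⟨ha'.1, le_rfl, ha'.2.2⟩⟩
      have hWle : W.card ≤ R n + 1 := by omega
      rw [ih (by omega) (colsKeep W (R b) a) (mem_filter.2 ⟨h0, by omega⟩)
        (fun v hv => hW v (mem_filter.1 hv).1)
        (fun v h1 h2 => mem_filter.2 ⟨hW' v (by omega) h2, by omega⟩),
        show R n + 1 - (colsKeep W (R b) a).card = i + ((colsFrom W (R b) a).card - 1) by omega]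
      by_cases h : a = 0
      · subst h
        -- Column `0` can never be dropped, because the root `(0, n)` lies in it.
        have hempty : faceSum R n J t y (n - d) (colsDrop W (R b) 0) = 0 := by
          rw [faceSum, show partialFaces R n (n - d) (colsDrop W (R b) 0) = ∅ from ?_, sum_empty]
          rw [eq_empty_iff_forall_notMem]
          intro C hC
          have := (mem_filter.1 ((mem_partialFaces.1 hC).col_mem _
            (mem_partialFaces.1 hC).root_mem)).2
          simp only at this
          omega
        rw [hempty]
        change y ^ (if 0 = 0 ∧ 2 ≤ k ∧ b ∈ J then 1 else 0) * (A (i + (k - 1)) + t * 0) =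
          (if k = k ∧ 2 ≤ k ∧ b ∈ J then y else 1) * A (i + (k - 1)) +
            if k = k then 0 else t * A (i + k)
        simp only [true_and, if_true, mul_zero, add_zero]
        split_ifs <;> simp
      · rw [ih (by omega) (colsDrop W (R b) a) (mem_filter.2 ⟨h0, by omega⟩)
          (fun v hv => hW v (mem_filter.1 hv).1)
          (fun v h1 h2 => mem_filter.2 ⟨hW' v (by omega) h2, by omega⟩),
          show R n + 1 - (colsDrop W (R b) a).card = i + (colsFrom W (R b) a).card by omega]
        have hc : (colsFrom W (R b) a).card ≠ k := fun hc => h ((hzero a ha).2 hc)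
        simp [h, hc, A]
    rw [sum_congr rfl hstep, sum_card_colsFrom (fun c => (if c = k ∧ 2 ≤ c ∧ b ∈ J then y else 1) *
      A (i + (c - 1)) + if c = k then 0 else t * A (i + c)) W (R b)]
    change ∑ q ∈ range k, _ = _
    obtain ⟨m, hm⟩ : ∃ m, k = m + 1 := ⟨k - 1, by have := card_pos.2 ⟨0, hk0⟩; omega⟩
    -- The coefficient of `A (i + q)` gets `1` or `y` from keeping at count `q + 1` and, for `q >
    -- 0`, `t` from dropping at count `q`. The term `q = 0` is split off; it carries no `y`, since
    -- its row has a single point.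
    rw [show Icc i (R b) = Ico i (R b + 1) from rfl, sum_Ico_eq_sum_range,
      show R b + 1 - i = m + 1 by omega, hm, sum_add_distrib, sum_range_succ',
      sum_range_succ (fun q => if q + 1 = m + 1 then 0 else t * A (i + (q + 1))), sum_range_succ']
    have h1 : ∑ q ∈ range m, (if q + 1 = m + 1 then 0 else t * A (i + (q + 1))) =
        ∑ q ∈ range m, t * A (i + (q + 1)) :=
      sum_congr rfl fun q hq => if_neg (by have := mem_range.1 hq; omega)
    rw [h1, if_pos rfl, add_zero, add_right_comm, ← sum_add_distrib]
    congr 1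
    · refine sum_congr rfl fun q hq => ?_
      have hq' := mem_range.1 hq
      rw [if_neg (show i + (q + 1) ≠ i by omega)]
      by_cases hqm : q + 1 = m ∧ b ∈ J
      · rw [if_pos ⟨by omega, by omega, hqm.2⟩, if_pos ⟨by simp only; omega, hqm.2⟩]
        simp only [Nat.add_sub_cancel]
        ring
      · rw [if_neg (fun h => hqm ⟨by omega, h.2.2⟩),
          if_neg (fun h => hqm ⟨by have := h.1; simp only at this; omega, h.2⟩)]
        simp only [Nat.add_sub_cancel]
        ring
    · simp

/-! ### Return to `ν`: the path-face identity and the two triangles -/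

theorem isPartialFace_iff {ν : NEPath} {C : Finset (ℕ × ℕ)} :
    IsPartialFace (rowEnd ν) (endpoint ν).2 0 (range ((endpoint ν).1 + 1)) C ↔
      IsCoveringFace ν C := by
  have hsub {C : Finset (ℕ × ℕ)} (h : C ⊆ region ν) {p : ℕ × ℕ} (hp : p ∈ C) :=
    mem_region.1 (h hp)
  -- The diagram is closed under moving up or left, so the rectangle lies in it exactly when its
  -- lower right corner does.
  have hinc {p q : ℕ × ℕ} (hq : q.2 ≤ (endpoint ν).2) (h1 : p.1 < q.1) (h2 : p.2 < q.2) :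
      Icc (p ⊓ q) (p ⊔ q) ⊆ region ν ↔ q.1 ≤ rowEnd ν p.2 := by
    rw [inf_eq_left.2 (show p ≤ q from ⟨h1.le, h2.le⟩),
      sup_eq_right.2 (show p ≤ q from ⟨h1.le, h2.le⟩)]
    constructor
    · intro h
      exact (mem_region.1 (h (mem_Icc.2
        ⟨show p ≤ (q.1, p.2) from ⟨h1.le, le_rfl⟩, show (q.1, p.2) ≤ q from ⟨le_rfl, h2.le⟩⟩))).2
    · intro h u hu
      obtain ⟨hu1, hu2⟩ := mem_Icc.1 hu
      exact mem_region.2 ⟨hu2.2.trans hq, (hu2.1.trans h).trans (rowEnd_mono ν hu1.2)⟩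
  constructor
  · intro h
    refine ⟨⟨fun p hp => mem_region.2 ⟨h.row_le p hp, h.col_le p hp⟩, ?_⟩, h.root_mem, ?_, ?_⟩
    · rintro p hp q hq ⟨h1 | h1, h2⟩
      · rw [hinc (h.row_le q hq) h1.1 h1.2] at h2
        exact h2.not_gt (h.compat p hp q hq h1.1 h1.2)
      · rw [inf_comm, sup_comm, hinc (h.row_le p hp) h1.1 h1.2] at h2
        exact h2.not_gt (h.compat q hq p hp h1.1 h1.2)
    · intro i hi
      obtain ⟨j, hj⟩ := h.col_cover i hi
      exact ⟨_, hj, rfl⟩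
    · intro j hj
      obtain ⟨i, hi⟩ := h.row_cover j (Nat.zero_le _) (Nat.lt_succ_iff.1 (mem_range.1 hj))
      exact ⟨_, hi, rfl⟩
  · rintro ⟨⟨h1, h2⟩, h3, h4, h5⟩
    refine ⟨fun p hp => ?_, fun p _ => Nat.zero_le _, fun p hp => (hsub h1 hp).1,
      fun p hp => (hsub h1 hp).2, fun p hp q hq h h' => ?_, h3, fun i hi => ?_, fun j _ hj => ?_⟩
    · exact mem_range.2 (Nat.lt_succ_iff.2 ((hsub h1 hp).2.trans (rowEnd_le _ _)))
    · by_contra hle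
      exact h2 p hp q hq ⟨Or.inl ⟨h, h'⟩, (hinc (hsub h1 hq).1 h h').2 (not_lt.1 hle)⟩
    · obtain ⟨p, hp, rfl⟩ := h4 i hi
      exact ⟨p.2, hp⟩
    · obtain ⟨p, hp, rfl⟩ := h5 j (mem_range.2 (Nat.lt_succ_iff.2 hj))
      exact ⟨p.1, hp⟩

theorem relPoints_valleyRows (ν : NEPath) (C : Finset (ℕ × ℕ)) :
    relPoints (valleyRows ν) C = Rel ν C := by
  simp only [relPoints, Rel, valleyRows, mem_image]

theorem ret_le_val (ν μ : NEPath) : ret ν μ ≤ val μ := card_le_card inter_subset_left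

theorem val_le_deg {ν μ : NEPath} (h : μ ∈ nuPaths ν) : val μ ≤ deg ν := le_sup h

theorem card_le_of_mem_asso {ν : NEPath} {C : Finset (ℕ × ℕ)} (hC : C ∈ asso ν) :
    C.card ≤ (endpoint ν).1 + 1 + (endpoint ν).2 := by
  simpa using (isPartialFace_iff.2 (mem_asso.1 hC)).card_le (Nat.zero_le _)

/-- Counting faces by dimension and relevant points amounts to counting paths with a marked set
of valleys. -/
theorem sum_asso_eq_sum_nuPaths {K : Type*} [CommSemiring K] (ν : NEPath) (t y : K) :
    ∑ C ∈ asso ν, t ^ (dim ν C).toNat * y ^ rel ν C =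
      ∑ μ ∈ nuPaths ν, (1 + t) ^ (val μ - ret ν μ) * (y + t) ^ ret ν μ := by
  have hF := faceSum_eq_rowSum (rowEnd_mono ν) (top_notMem_valleyRows ν) t y _ le_rfl
    (range ((endpoint ν).1 + 1)) (by simp) (by simp [rowEnd_top])
    (by simp [rowEnd_top])
  have hP := pathSum_eq_rowSum (rowEnd_mono ν) (endpoint ν).2
    (fun p => if p.1 = rowEnd ν p.2 ∧ p.2 ∈ valleyRows ν then y + t else 1 + t)
    (endpoint ν).2 0 le_rfl (Nat.zero_le _)
  -- With all columns present none has been discarded, so the recursion starts at column `0`, like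
  -- the paths.
  rw [card_range, rowEnd_top, Nat.sub_self, Nat.sub_self] at hF
  rw [Nat.sub_self, Nat.sub_zero, ← hF, pathSum, pathsFrom_eq_nuPaths, faceSum] at hP
  have hA : partialFaces (rowEnd ν) (endpoint ν).2 0 (range ((endpoint ν).1 + 1)) = asso ν := by
    ext C
    rw [mem_partialFaces, isPartialFace_iff, mem_asso]
  rw [hA] at hP
  convert hP.symm using 1
  · refine sum_congr rfl fun C _ => ?_
    rw [relPoints_valleyRows, rel, card_range]
    congr 2
    rw [dim]
    omega
  · refine sum_congr rfl fun μ _ => ?_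
    simp only [← mem_valleys_iff]
    rw [valleysFrom_origin, prod_ite, prod_const, prod_const, mul_comm, filter_mem_eq_inter]
    congr 2
    have := card_filter_add_card_filter_not (s := valleys μ) (fun p => p ∈ valleys ν)
    rw [filter_mem_eq_inter] at this
    rw [val, ret]
    omega

/-- Set both variables to `X` over `ℕ`. Each path contributes degree at most its number of valleys,
hence at most `deg ν`; with natural coefficients no face's monomial `X ^ (dim + rel)` can cancel. -/
theorem dim_add_rel_le_deg {ν : NEPath} {C : Finset (ℕ × ℕ)} (hC : C ∈ asso ν) :
    (dim ν C).toNat + rel ν C ≤ deg ν := by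
  have h := congr_arg (Polynomial.coeff · ((dim ν C).toNat + rel ν C))
    (sum_asso_eq_sum_nuPaths ν (Polynomial.X : Polynomial ℕ) Polynomial.X)
  simp only [← pow_add, Polynomial.finsetSum_coeff, Polynomial.coeff_X_pow] at h
  by_contra hlt
  rw [sum_eq_zero (s := nuPaths ν)] at h
  · have := (sum_eq_zero_iff.1 h) C hC
    simp at this
  · intro μ hμ
    apply Polynomial.coeff_eq_zero_of_natDegree_lt
    have h1 : (1 + Polynomial.X : Polynomial ℕ).natDegree ≤ 1 := by
      compute_degree
    have h2 : (Polynomial.X + Polynomial.X : Polynomial ℕ).natDegree ≤ 1 := by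
      compute_degree
    have h3 := Polynomial.natDegree_mul_le_of_le
      (Polynomial.natDegree_pow_le_of_le (val μ - ret ν μ) h1)
      (Polynomial.natDegree_pow_le_of_le (ret ν μ) h2)
    have := ret_le_val ν μ
    have := val_le_deg hμ
    omega

theorem corel_eq {ν : NEPath} {C : Finset (ℕ × ℕ)} (hC : C ∈ asso ν) :
    corel ν C = (deg ν - ((dim ν C).toNat + rel ν C) : ℕ) := by
  have h1 := dim_add_rel_le_deg hC
  have h2 := card_le_of_mem_asso hC
  have h3 : 0 ≤ dim ν C := by
    rw [dim]
    omega
  rw [corel]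
  omega

/-- The `F`-triangle as a sum over paths. -/
theorem aeval_FTriangle {K : Type*} [Field K] (ν : NEPath) {x y : K} (hx : x ≠ 0) :
    MvPolynomial.aeval ![x, y] (FTriangle ν) = x ^ deg ν *
      ∑ μ ∈ nuPaths ν, ((x + 1) / x) ^ (val μ - ret ν μ) * ((y + 1) / x) ^ ret ν μ := by
  -- These values turn a face's term into `x ^ (-dim - rel) * y ^ rel`, and the factor `x ^ deg ν`
  -- completes the exponent to `corel`.
  have h := sum_asso_eq_sum_nuPaths ν (1 / x) (y / x)
  rw [← add_div, show 1 + 1 / x = (x + 1) / x by field_simp] at h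
  rw [← h, FTriangle, map_sum, mul_sum]
  refine sum_congr rfl fun C hC => ?_
  have hle := dim_add_rel_le_deg hC
  simp only [map_mul, map_pow, MvPolynomial.aeval_X, corel_eq hC, Int.toNat_natCast]
  simp only [Matrix.cons_val_zero, Matrix.cons_val_one, Matrix.cons_val_fin_one]
  obtain ⟨e, he⟩ := Nat.exists_eq_add_of_le hle
  rw [he, Nat.add_sub_cancel_left, div_pow, div_pow, one_pow, pow_add, pow_add]
  field_simp

theorem aeval_HTriangle {K : Type*} [Field K] (ν : NEPath) (x y : K) :
    MvPolynomial.aeval ![x, y] (HTriangle ν) =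
      ∑ μ ∈ nuPaths ν, x ^ (val μ - ret ν μ) * (x * y) ^ ret ν μ := by
  rw [HTriangle, map_sum]
  refine sum_congr rfl fun μ _ => ?_
  simp only [map_mul, map_pow, MvPolynomial.aeval_X]
  simp only [Matrix.cons_val_zero, Matrix.cons_val_one, Matrix.cons_val_fin_one]
  rw [mul_pow, ← mul_assoc, ← pow_add, Nat.sub_add_cancel (ret_le_val ν μ)]

end NuTamari

/-- The `F`-triangle is well defined (its exponents are nonnegative), and both substitution formulas
hold at all points `x`, `y` of every field where no denominator vanishes. Taking for the field the
rational functions in the indeterminates `x` and `y` gives the identities of rational functions. -/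
theorem theorem1p1 (ν : NuTamari.NEPath) :
    (∀ C ∈ NuTamari.asso ν, 0 ≤ NuTamari.corel ν C) ∧
    (∀ (K : Type*) [Field K] (x y : K), x ≠ 0 → x + 1 ≠ 0 →
      MvPolynomial.aeval ![x, y] (NuTamari.FTriangle ν) =
        x ^ NuTamari.deg ν *
          MvPolynomial.aeval ![(x + 1) / x, (y + 1) / (x + 1)] (NuTamari.HTriangle ν)) ∧
    (∀ (K : Type*) [Field K] (x y : K), x ≠ 1 →
      MvPolynomial.aeval ![x, y] (NuTamari.HTriangle ν) =
        (x - 1) ^ NuTamari.deg ν *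
          MvPolynomial.aeval ![1 / (x - 1), (x * (y - 1) + 1) / (x - 1)]
            (NuTamari.FTriangle ν)) := by
  refine ⟨fun C hC => ?_, fun K _ x y hx hx1 => ?_, fun K _ x y hx => ?_⟩
  · rw [NuTamari.corel_eq hC]
    exact Int.natCast_nonneg _
  · rw [NuTamari.aeval_FTriangle ν hx, NuTamari.aeval_HTriangle, div_mul_div_cancel₀' hx1]
  · have hx' : x - 1 ≠ 0 := sub_ne_zero.2 hx
    rw [NuTamari.aeval_FTriangle ν (one_div_ne_zero hx'), NuTamari.aeval_HTriangle, ← mul_assoc,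
      ← mul_pow, mul_one_div_cancel hx', one_pow, one_mul,
      -- The weights of non-return valleys and of returns under the inverse substitution, to be
      -- compared with those in `H`.
      show (1 / (x - 1) + 1) / (1 / (x - 1)) = x by field_simp; ring,
      show ((x * (y - 1) + 1) / (x - 1) + 1) / (1 / (x - 1)) = x * y by field_simp; ring]
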